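/- All manifolds and maps are smooth ($C^\infty$), and $I=[0,1]$. A smooth isotopy of a manifold $N$ (possibly with boundary) is a family $(h_t)_{t\in I}$ of diffeomorphisms of $N$ such that $(t,p)\mapsto h_t(p)$ and $(t,p)\mapsto h_t^{-1}(p)$ are smooth on $I\times N$; then $h_0$ and $h_1$ are called isotopic. $\mathrm{Diff}(N)$ is the group of diffeomorphisms of $N$ and $\mathrm{Diff}(N\ \mathrm{rel}\ \partial)$ is the subgroup of those that are the identity in a neighborhood of $\partial N$. Two elements of $\mathrm{Diff}(N\ \mathrm{rel}\ \partial)$ are isotopic rel boundary if they are joined by a smooth isotopy in $\mathrm{Diff}(N\ \mathrm{rel}\ \partial)$ that is constantly the identity on a neighborhood of $\partial N$. $\pi_0\mathrm{Diff}(N)$ and $\pi_0\mathrm{Diff}(N\ \mathrm{rel}\ \partial)$ are the groups of isotopy classes, resp. of isotopy classes rel boundary. Lemma ("closing the clam"). Let $M$ be a closed (compact, without boundary, not necessarily connected or orientable) smooth manifold. For $g\in\mathrm{Diff}(M\times I\ \mathrm{rel}\ \partial)$ let $\overline g\in \mathrm{Diff}(M\times S^1)$ be the closure of $g$, that is, the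 diffeomorphism with $\overline g\circ q=q\circ g$, where $q:M\times I\to M\times S^1$, $q(x,s)=(x,e^{2\pi i s})$, identifies top and bottom. Then the homomorphism $$\pi_0\mathrm{Diff}(M\times I\ \mathrm{rel}\ \partial)\to\pi_0\mathrm{Diff}(M\times S^1),\qquad [g]\mapsto[\overline g],$$ is injective. Equivalently, if $g\in\mathrm{Diff}(M\times I\ \mathrm{rel}\ \partial)$ and $\overline g$ is isotopic to the identity of $M\times S^1$, then $g$ is isotopic to the identity of $M\times I$ rel boundary. -/

import Mathlib

open scoped Manifold ContDiff Topology

noncomputable section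

namespace ClosingClam

section General

variable {E : Type*} [NormedAddCommGroup E] [NormedSpace ℝ E]
  {H : Type*} [TopologicalSpace H] (I : ModelWithCorners ℝ E H)
  (N : Type*) [TopologicalSpace N] [ChartedSpace H N]

/-- The smooth (`C^∞`) diffeomorphisms of a manifold `N`, possibly with boundary. -/
abbrev Diff : Type _ := N ≃ₘ^∞⟮I, I⟯ N

/-- `Diff(N)` is a group under composition: `(φ * ψ) p = φ (ψ p)`. -/
instance instGroupDiff : Group (Diff I N) where
  mul φ ψ := ψ.trans φ
  one := Diffeomorph.refl I N ∞
  inv φ := φ.symm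
  mul_assoc _ _ _ := rfl
  one_mul _ := rfl
  mul_one _ := rfl
  inv_mul_cancel φ := Diffeomorph.ext fun x => φ.symm_apply_apply x

variable {I N}

@[simp] theorem mul_apply (φ ψ : Diff I N) (p : N) : (φ * ψ) p = φ (ψ p) := rfl

@[simp] theorem one_apply (p : N) : (1 : Diff I N) p = p := rfl

@[simp] theorem inv_apply_self (φ : Diff I N) (p : N) : φ⁻¹ (φ p) = p := φ.symm_apply_apply p

@[simp] theorem apply_inv_self (φ : Diff I N) (p : N) : φ (φ⁻¹ p) = p := φ.apply_symm_apply p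

/-- A smooth isotopy of `N`: a family `h t` (`0 ≤ t ≤ 1`) of diffeomorphisms such that
`(t, p) ↦ h t p` and `(t, p) ↦ (h t)⁻¹ p` are smooth on `[0,1] × N`, that is, a smooth level
preserving diffeomorphism of `[0,1] × N`. -/
def IsIsotopy (h : unitInterval → Diff I N) : Prop :=
  ContMDiff ((𝓡∂ 1).prod I) I ∞ (fun p : unitInterval × N => h p.1 p.2) ∧
    ContMDiff ((𝓡∂ 1).prod I) I ∞ (fun p : unitInterval × N => (h p.1)⁻¹ p.2)

/-- Two diffeomorphisms are isotopic if a smooth isotopy joins them. -/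
def Isotopic (φ ψ : Diff I N) : Prop :=
  ∃ h : unitInterval → Diff I N, IsIsotopy h ∧ h 0 = φ ∧ h 1 = ψ

theorem isIsotopy_const (φ : Diff I N) : IsIsotopy (fun _ => φ) :=
  ⟨φ.contMDiff.comp contMDiff_snd, φ.symm.contMDiff.comp contMDiff_snd⟩

theorem IsIsotopy.inv {h : unitInterval → Diff I N} (hh : IsIsotopy h) :
    IsIsotopy (fun t => (h t)⁻¹) := ⟨hh.2, by simpa using hh.1⟩

theorem IsIsotopy.mul {h k : unitInterval → Diff I N} (hh : IsIsotopy h) (hk : IsIsotopy k) :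
    IsIsotopy (fun t => h t * k t) :=
  ⟨hh.1.comp (contMDiff_fst.prodMk hk.1), by
    simp only [mul_inv_rev, mul_apply]
    exact hk.2.comp (contMDiff_fst.prodMk hh.2)⟩

variable (I N)

/-- `Diff(N)_0`: the diffeomorphisms of `N` that are isotopic to the identity. -/
def diffZero : Subgroup (Diff I N) where
  carrier := {φ | Isotopic 1 φ}
  one_mem' := ⟨fun _ => 1, isIsotopy_const 1, rfl, rfl⟩
  mul_mem' := by
    rintro _ _ ⟨h, hh, h0, rfl⟩ ⟨k, hk, k0, rfl⟩
    exact ⟨fun t => h t * k t, hh.mul hk, by simp [h0, k0], rfl⟩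
  inv_mem' := by
    rintro _ ⟨h, hh, h0, rfl⟩
    exact ⟨fun t => (h t)⁻¹, hh.inv, by simp [h0], rfl⟩

instance diffZero_normal : (diffZero I N).Normal where
  conj_mem := by
    rintro _ ⟨h, hh, h0, rfl⟩ φ
    exact ⟨fun t => φ * h t * φ⁻¹,
      ((isIsotopy_const φ).mul hh).mul (isIsotopy_const φ⁻¹), by simp [h0], rfl⟩

/-- `π₀ Diff(N)`, the group of isotopy classes of diffeomorphisms of `N`. -/
abbrev PiZeroDiff : Type _ := Diff I N ⧸ diffZero I N

/-- `Diff(N rel ∂)`: the diffeomorphisms of `N` that are the identity near the boundary of `N`. -/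
def diffRel : Subgroup (Diff I N) where
  carrier := {φ | ∀ᶠ p in 𝓝ˢ (I.boundary N), φ p = p}
  one_mem' := by simp
  mul_mem' := by
    intro φ ψ hφ hψ
    rw [Set.mem_ofPred_eq] at hφ hψ ⊢
    filter_upwards [hφ, hψ] with p h1 h2
    rw [mul_apply, h2, h1]
  inv_mem' := by
    intro φ hφ
    rw [Set.mem_ofPred_eq] at hφ ⊢
    filter_upwards [hφ] with p h1
    conv_lhs => rw [← h1]
    simp

variable {I N}

/-- An isotopy rel boundary: a smooth isotopy that is constantly the identity near the
boundary. -/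
def IsIsotopyRel (h : unitInterval → diffRel I N) : Prop :=
  IsIsotopy (fun t => (h t : Diff I N)) ∧
    ∀ᶠ p in 𝓝ˢ (I.boundary N), ∀ t, (h t : Diff I N) p = p

/-- Two elements of `Diff(N rel ∂)` are isotopic rel boundary if an isotopy rel boundary
joins them. -/
def IsotopicRel (g g' : diffRel I N) : Prop :=
  ∃ h : unitInterval → diffRel I N, IsIsotopyRel h ∧ h 0 = g ∧ h 1 = g'

theorem isIsotopyRel_const (g : diffRel I N) : IsIsotopyRel (fun _ => g) :=
  ⟨isIsotopy_const _, by
    have h : ∀ᶠ p in 𝓝ˢ (I.boundary N), (g : Diff I N) p = p := g.2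
    filter_upwards [h] with p hp _ using hp⟩

theorem IsIsotopyRel.inv {h : unitInterval → diffRel I N} (hh : IsIsotopyRel h) :
    IsIsotopyRel (fun t => (h t)⁻¹) :=
  ⟨hh.1.inv, by
    filter_upwards [hh.2] with p hp t
    conv_lhs => rw [← hp t]
    simp⟩

theorem IsIsotopyRel.mul {h k : unitInterval → diffRel I N} (hh : IsIsotopyRel h)
    (hk : IsIsotopyRel k) : IsIsotopyRel (fun t => h t * k t) :=
  ⟨hh.1.mul hk.1, by
    filter_upwards [hh.2, hk.2] with p hp kp t
    rw [Subgroup.coe_mul, mul_apply, kp t, hp t]⟩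

variable (I N)

/-- The elements of `Diff(N rel ∂)` that are isotopic to the identity rel boundary. -/
def diffRelZero : Subgroup (diffRel I N) where
  carrier := {g | IsotopicRel 1 g}
  one_mem' := ⟨fun _ => 1, isIsotopyRel_const 1, rfl, rfl⟩
  mul_mem' := by
    rintro _ _ ⟨h, hh, h0, rfl⟩ ⟨k, hk, k0, rfl⟩
    exact ⟨fun t => h t * k t, hh.mul hk, by simp [h0, k0], rfl⟩
  inv_mem' := by
    rintro _ ⟨h, hh, h0, rfl⟩
    exact ⟨fun t => (h t)⁻¹, hh.inv, by simp [h0], rfl⟩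

instance diffRelZero_normal : (diffRelZero I N).Normal where
  conj_mem := by
    rintro _ ⟨h, hh, h0, rfl⟩ g
    exact ⟨fun t => g * h t * g⁻¹,
      ((isIsotopyRel_const g).mul hh).mul (isIsotopyRel_const g⁻¹), by simp [h0], rfl⟩

/-- `π₀ Diff(N rel ∂)`, the group of isotopy classes rel boundary. -/
abbrev PiZeroDiffRel : Type _ := diffRel I N ⧸ diffRelZero I N

variable {I N}

/-- Two diffeomorphisms are in the same class of `π₀ Diff(N)` exactly if they are isotopic. -/
theorem mk_eq_mk_iff (φ ψ : Diff I N) :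
    (φ : PiZeroDiff I N) = (ψ : PiZeroDiff I N) ↔ Isotopic φ ψ := by
  rw [QuotientGroup.eq]
  constructor
  · rintro ⟨h, hh, h0, h1⟩
    exact ⟨fun t => φ * h t, (isIsotopy_const φ).mul hh, by simp [h0], by simp [h1]⟩
  · rintro ⟨h, hh, rfl, rfl⟩
    exact ⟨fun t => (h 0)⁻¹ * h t, (isIsotopy_const _).mul hh, by simp, rfl⟩

/-- The same for `π₀ Diff(N rel ∂)`. -/
theorem mk_eq_mk_rel_iff (g g' : diffRel I N) :
    (g : PiZeroDiffRel I N) = (g' : PiZeroDiffRel I N) ↔ IsotopicRel g g' := by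
  rw [QuotientGroup.eq]
  constructor
  · rintro ⟨h, hh, h0, h1⟩
    exact ⟨fun t => g * h t, (isIsotopyRel_const g).mul hh, by simp [h0], by simp [h1]⟩
  · rintro ⟨h, hh, rfl, rfl⟩
    exact ⟨fun t => (h 0)⁻¹ * h t, (isIsotopyRel_const _).mul hh, by simp, rfl⟩

end General

/-! The circle as the interval with its end points identified. -/

/-- The quotient map `[0,1] → S¹`, `s ↦ exp(2πis)`. -/
def wrap (s : unitInterval) : Circle := Circle.exp (2 * Real.pi * s)

/-- The angle of `z`, as a fraction in `(0,1]` of a full turn. -/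
def angle (z : Circle) : ℝ := 1 / 2 + Complex.arg (-(z : ℂ)) / (2 * Real.pi)

theorem angle_mem (z : Circle) : angle z ∈ Set.Icc (0 : ℝ) 1 := by
  have h1 := Complex.neg_pi_lt_arg (-(z : ℂ))
  have h2 := Complex.arg_le_pi (-(z : ℂ))
  have hp := Real.pi_pos
  have e : angle z = (Real.pi + Complex.arg (-(z : ℂ))) / (2 * Real.pi) := by
    unfold angle; field_simp
  rw [e]
  constructor
  · apply div_nonneg <;> linarith
  · rw [div_le_one (by linarith)]; linarith

/-- A section of `wrap`, smooth away from `1 : S¹`. -/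
def cut (z : Circle) : unitInterval := Set.projIcc 0 1 zero_le_one (angle z)

theorem coe_cut (z : Circle) : (cut z : ℝ) = angle z := by
  rw [cut, Set.projIcc_of_mem zero_le_one (angle_mem z)]

theorem wrap_cut (z : Circle) : wrap (cut z) = z := by
  have hp := Real.pi_pos
  apply Circle.ext
  have e : 2 * Real.pi * angle z = Real.pi + Complex.arg (-(z : ℂ)) := by
    unfold angle; field_simp
  have h := Complex.norm_mul_exp_arg_mul_I (-(z : ℂ))
  rw [norm_neg, Circle.norm_coe, Complex.ofReal_one, one_mul] at h
  rw [wrap, coe_cut, e, Circle.coe_exp]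
  push_cast
  rw [add_mul, Complex.exp_add, Complex.exp_pi_mul_I, h]
  simp

/-- `wrap` identifies nothing but the two end points. -/
theorem wrap_eq_wrap {s t : unitInterval} (h : wrap s = wrap t) :
    s = t ∨ (s = 0 ∨ s = 1) ∧ (t = 0 ∨ t = 1) := by
  have hp := Real.pi_pos
  rw [wrap, wrap, Circle.exp_eq_exp] at h
  obtain ⟨m, hm⟩ := h
  have e : (s : ℝ) = t + m := by
    have : (2 * Real.pi) * (s : ℝ) = (2 * Real.pi) * (t + m) := by rw [hm]; ring
    exact mul_left_cancel₀ (by positivity) this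
  have s0 := s.2.1
  have s1 := s.2.2
  have t0 := t.2.1
  have t1 := t.2.2
  have m1 : m < 2 := by
    have : (m : ℝ) < 2 := by linarith
    exact_mod_cast this
  have m2 : -2 < m := by
    have : (-2 : ℝ) < m := by linarith
    exact_mod_cast this
  have hm3 : m = -1 ∨ m = 0 ∨ m = 1 := by omega
  rcases hm3 with rfl | rfl | rfl
  · right
    push_cast at e
    exact ⟨Or.inl (Subtype.ext (by show (s : ℝ) = 0; linarith)),
      Or.inr (Subtype.ext (by show (t : ℝ) = 1; linarith))⟩
  · left
    exact Subtype.ext (by simpa using e)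
  · right
    push_cast at e
    exact ⟨Or.inr (Subtype.ext (by show (s : ℝ) = 1; linarith)),
      Or.inl (Subtype.ext (by show (t : ℝ) = 0; linarith))⟩

theorem wrap_zero : wrap 0 = 1 := by simp [wrap]

theorem wrap_one : wrap 1 = 1 := by simp [wrap]

theorem contMDiff_wrap : ContMDiff (𝓡∂ 1) (𝓡 1) ∞ wrap :=
  contMDiff_circleExp.comp
    ((contDiff_const.mul contDiff_id).contMDiff.comp contMDiff_subtypeVal_Icc)

attribute [local instance] finrank_real_complex_fact' in
theorem contMDiffAt_cut {z : Circle} (hz : z ≠ 1) : ContMDiffAt (𝓡 1) (𝓡∂ 1) ∞ cut z := by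
  have hc : ContMDiff (𝓡 1) 𝓘(ℝ, ℂ) ∞ (fun w : Circle => (w : ℂ)) := contMDiff_coe_sphere
  have hs : -(z : ℂ) ∈ Complex.slitPlane := by
    by_contra h
    rw [Complex.mem_slitPlane_iff, not_or, not_lt, not_not, Complex.neg_re, Complex.neg_im] at h
    have h1 := Circle.normSq_coe z
    rw [Complex.normSq_apply] at h1
    have him : (z : ℂ).im = 0 := by linarith [h.2]
    have hre : (z : ℂ).re = 1 := by
      rw [him] at h1
      nlinarith [h.1]
    exact hz (Circle.ext (Complex.ext (by simpa using hre) (by simpa using him)))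
  have hl : ContDiffAt ℝ ∞ (fun w : ℂ => 1 / 2 + Complex.arg (-w) / (2 * Real.pi)) (z : ℂ) := by
    have h1 : ContDiffAt ℝ ∞ (fun w : ℂ => Complex.log (-w)) (z : ℂ) :=
      ((Complex.contDiffAt_log hs).restrict_scalars ℝ).comp _ contDiff_neg.contDiffAt
    have h2 : ContDiffAt ℝ ∞ (fun w : ℂ => Complex.arg (-w)) (z : ℂ) := by
      have := Complex.imCLM.contDiff.contDiffAt.comp _ h1
      refine this.congr_of_eventuallyEq (Filter.Eventually.of_forall fun w => ?_)
      simp [Complex.log_im]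
    exact contDiffAt_const.add (h2.div_const _)
  have ha : ContMDiffAt (𝓡 1) 𝓘(ℝ, ℝ) ∞ angle z := hl.contMDiffAt.comp z hc.contMDiffAt
  have hp := contMDiffOn_projIcc (x := (0 : ℝ)) (y := 1) (n := ∞) (angle z) (angle_mem z)
  rw [← contMDiffWithinAt_univ] at ha ⊢
  exact hp.comp z ha fun w _ => angle_mem w

theorem tendsto_cut : Filter.Tendsto cut (𝓝 1) (𝓝 0 ⊔ 𝓝 1) := by
  intro V hV
  have hV' : V ∈ 𝓝ˢ ({0, 1} : Set unitInterval) := by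
    rw [nhdsSet_insert, nhdsSet_singleton]
    exact hV
  obtain ⟨U, hU, h01, hUV⟩ := mem_nhdsSet_iff_exists.1 hV'
  have hK : IsClosed (wrap '' Uᶜ) :=
    (hU.isClosed_compl.isCompact.image contMDiff_wrap.continuous).isClosed
  have h1 : (1 : Circle) ∉ wrap '' Uᶜ := by
    rintro ⟨s, hs, h⟩
    apply hs
    rcases wrap_eq_wrap (h.trans wrap_zero.symm) with rfl | ⟨rfl | rfl, -⟩
    · exact h01 (by simp)
    · exact h01 (by simp)
    · exact h01 (by simp)
  rw [Filter.mem_map]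
  filter_upwards [hK.isOpen_compl.mem_nhds h1] with z hz
  apply hUV
  by_contra h
  exact hz ⟨cut z, h, wrap_cut z⟩

section Glue

variable {n : ℕ} {M : Type*} [TopologicalSpace M] [ChartedSpace (EuclideanSpace ℝ (Fin n)) M]

/-- The quotient map `M × I → M × S¹` that identifies the top `M × 1` with the bottom `M × 0`. -/
def glueEnds {X : Type*} (p : X × unitInterval) : X × Circle := (p.1, wrap p.2)

theorem glueEnds_surjective {X : Type*} :
    Function.Surjective (glueEnds : X × unitInterval → X × Circle) :=
  fun w => ⟨(w.1, cut w.2), Prod.ext rfl (wrap_cut w.2)⟩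

theorem contMDiff_glueEnds :
    ContMDiff ((𝓡 n).prod (𝓡∂ 1)) ((𝓡 n).prod (𝓡 1)) ∞ (glueEnds (X := M)) :=
  contMDiff_fst.prodMk (contMDiff_wrap.comp contMDiff_snd)

theorem boundary_cylinder : ((𝓡 n).prod (𝓡∂ 1)).boundary (M × unitInterval) =
    (Set.univ : Set M) ×ˢ ({0, 1} : Set unitInterval) :=
  boundary_product (𝓡 n)

theorem mem_nhds_of_boundary {V : Set (M × unitInterval)}
    (hV : V ∈ 𝓝ˢ (((𝓡 n).prod (𝓡∂ 1)).boundary (M × unitInterval))) {s : unitInterval}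
    (hs : s = 0 ∨ s = 1) (x : M) : V ∈ 𝓝 (x, s) := by
  rw [boundary_cylinder] at hV
  exact mem_nhdsSet_iff_forall.1 hV (x, s) ⟨trivial, hs⟩

/-- The map of `M × S¹` induced by a map of `M × I`. -/
def glueMap (f : M × unitInterval → M × unitInterval) (w : M × Circle) : M × Circle :=
  glueEnds (f (w.1, cut w.2))

theorem apply_of_end (g : diffRel ((𝓡 n).prod (𝓡∂ 1)) (M × unitInterval)) {s : unitInterval}
    (hs : s = 0 ∨ s = 1) (x : M) : g.1 (x, s) = (x, s) := by
  have h := mem_of_mem_nhds (mem_nhds_of_boundary g.2 hs x)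
  exact h

theorem glueMap_glueEnds (g : diffRel ((𝓡 n).prod (𝓡∂ 1)) (M × unitInterval))
    (p : M × unitInterval) : glueMap g.1 (glueEnds p) = glueEnds (g.1 p) := by
  obtain ⟨x, s⟩ := p
  rcases wrap_eq_wrap (wrap_cut (wrap s)) with h | ⟨h, h'⟩
  · simp [glueMap, glueEnds, h]
  · simp only [glueMap, glueEnds]
    rw [apply_of_end g h', apply_of_end g h]
    simp [wrap_cut]

theorem contMDiff_glueMap {h : unitInterval → diffRel ((𝓡 n).prod (𝓡∂ 1)) (M × unitInterval)}
    (hh : IsIsotopyRel h) :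
    ContMDiff ((𝓡∂ 1).prod ((𝓡 n).prod (𝓡 1))) ((𝓡 n).prod (𝓡 1)) ∞
      (fun p : unitInterval × (M × Circle) => glueMap (h p.1).1 p.2) := by
  rintro ⟨t, x, z⟩
  by_cases hz : z = 1
  · subst hz
    have h0 := mem_nhds_of_boundary hh.2 (Or.inl rfl) x
    have h1 := mem_nhds_of_boundary hh.2 (Or.inr rfl) x
    have ht : Filter.Tendsto (fun w : M × Circle => (w.1, cut w.2)) (𝓝 (x, 1))
        (𝓝 (x, 0) ⊔ 𝓝 (x, 1)) := by
      rw [nhds_prod_eq, nhds_prod_eq, nhds_prod_eq, ← Filter.prod_sup]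
      exact Filter.tendsto_id.prodMap tendsto_cut
    have hw : ∀ᶠ w in 𝓝 ((x, 1) : M × Circle), ∀ t : unitInterval,
        (h t).1 (w.1, cut w.2) = (w.1, cut w.2) :=
      ht.eventually (Filter.eventually_sup.2 ⟨h0, h1⟩)
    have hs : ContMDiffAt ((𝓡∂ 1).prod ((𝓡 n).prod (𝓡 1))) ((𝓡 n).prod (𝓡 1)) ∞
        (fun p : unitInterval × (M × Circle) => p.2) (t, x, 1) := contMDiffAt_snd
    refine hs.congr_of_eventuallyEq ?_
    have hc : Filter.Tendsto (fun p : unitInterval × (M × Circle) => p.2) (𝓝 (t, x, 1))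
        (𝓝 (x, 1)) := continuous_snd.continuousAt
    filter_upwards [hc.eventually hw] with p hp
    rw [glueMap, hp p.1]
    exact Prod.ext rfl (wrap_cut p.2.2)
  · have hcut : ContMDiffAt ((𝓡∂ 1).prod ((𝓡 n).prod (𝓡 1))) (𝓡∂ 1) ∞
        (fun p : unitInterval × (M × Circle) => cut p.2.2) (t, x, z) :=
      ContMDiffAt.comp (t, x, z) (f := fun p : unitInterval × (M × Circle) => p.2.2)
        (contMDiffAt_cut hz) (contMDiff_snd.comp contMDiff_snd).contMDiffAt
    have hin : ContMDiffAt ((𝓡∂ 1).prod ((𝓡 n).prod (𝓡 1)))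
        ((𝓡∂ 1).prod ((𝓡 n).prod (𝓡∂ 1))) ∞
        (fun p : unitInterval × (M × Circle) => (p.1, (p.2.1, cut p.2.2))) (t, x, z) :=
      contMDiffAt_fst.prodMk
        ((contMDiff_fst.comp contMDiff_snd).contMDiffAt.prodMk hcut)
    exact (contMDiff_glueEnds.comp hh.1.1).contMDiffAt.comp (t, x, z) hin

theorem contMDiff_glueMap_const (g : diffRel ((𝓡 n).prod (𝓡∂ 1)) (M × unitInterval)) :
    ContMDiff ((𝓡 n).prod (𝓡 1)) ((𝓡 n).prod (𝓡 1)) ∞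
      (glueMap g.1) :=
  (contMDiff_glueMap (isIsotopyRel_const g)).comp
    (contMDiff_const (c := (0 : unitInterval)).prodMk contMDiff_id)

/-- The closure of a diffeomorphism `g` of `M × I` rel boundary: the diffeomorphism of `M × S¹`
obtained from `g` by identifying top and bottom. -/
def closeUp (g : diffRel ((𝓡 n).prod (𝓡∂ 1)) (M × unitInterval)) :
    Diff ((𝓡 n).prod (𝓡 1)) (M × Circle) where
  toFun := glueMap g.1
  invFun := glueMap (g⁻¹).1
  left_inv w := by
    obtain ⟨p, rfl⟩ := glueEnds_surjective w
    rw [glueMap_glueEnds, glueMap_glueEnds]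
    simp
  right_inv w := by
    obtain ⟨p, rfl⟩ := glueEnds_surjective w
    rw [glueMap_glueEnds, glueMap_glueEnds]
    simp
  contMDiff_toFun := contMDiff_glueMap_const g
  contMDiff_invFun := contMDiff_glueMap_const g⁻¹

/-- The closure of `g` is the unique map that `g` induces on the quotient `M × S¹`. -/
theorem closeUp_glueEnds (g : diffRel ((𝓡 n).prod (𝓡∂ 1)) (M × unitInterval))
    (p : M × unitInterval) : closeUp g (glueEnds p) = glueEnds (g.1 p) :=
  glueMap_glueEnds g p

variable (n M)

/-- The homomorphism `Diff(M × I rel ∂) → Diff(M × S¹)` that identifies top and bottom. -/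
def closeUpHom : diffRel ((𝓡 n).prod (𝓡∂ 1)) (M × unitInterval) →*
    Diff ((𝓡 n).prod (𝓡 1)) (M × Circle) :=
  MonoidHom.mk' closeUp fun g g' => Diffeomorph.ext fun w => by
    obtain ⟨p, rfl⟩ := glueEnds_surjective w
    rw [mul_apply, closeUp_glueEnds, closeUp_glueEnds, closeUp_glueEnds]
    simp

theorem diffRelZero_le_comap : diffRelZero ((𝓡 n).prod (𝓡∂ 1)) (M × unitInterval) ≤
    (diffZero ((𝓡 n).prod (𝓡 1)) (M × Circle)).comap (closeUpHom n M) := by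
  rintro _ ⟨h, hh, h0, rfl⟩
  exact ⟨fun t => closeUpHom n M (h t),
    ⟨contMDiff_glueMap hh, contMDiff_glueMap hh.inv⟩, by simp [h0], rfl⟩

/-- The homomorphism `π₀ Diff(M × I rel ∂) → π₀ Diff(M × S¹)` that `closeUpHom` induces. -/
def piZeroCloseUp : PiZeroDiffRel ((𝓡 n).prod (𝓡∂ 1)) (M × unitInterval) →*
    PiZeroDiff ((𝓡 n).prod (𝓡 1)) (M × Circle) :=
  QuotientGroup.map _ _ (closeUpHom n M) (diffRelZero_le_comap n M)

end Glue

end ClosingClam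

end

/-!
Lift an isotopy from `1` to the closure of `g` to an isotopy `h` of `M × ℝ` through periodic
diffeomorphisms, starting at `1`; after a vertical shift, `h 1` extends `g`. The support of `h` is
not compact. First let the isotopy run only up to time `ρ` at height `s`, where `ρ s` grows from
`0` far below to `1` on `s ≥ 0`. If `ρ` grows slowly enough, the equation `h (ρ p) p = q` for `p`
becomes a fixed point problem for a contraction, so this is a diffeomorphism and gives an isotopy
`P` that is the identity far below and periodic on `s ≥ 0`.

Now let `σ` shift the line up by `1` above `0`, opening a gap of length `1`. Far above, `P t`
commutes with `σ`, and far below it is the identity, so the commutator `⁅P t, σ⁆` is compactly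
supported. At time `1` the map `P 1` preserves each `M × [m, m + 1]` with `m ≥ 0`, and all the
copies of `g` cancel in the commutator except the one on `M × [0, 1]`. Finally, a vertical stretch
that is the identity where `g` is supported commutes with this commutator, and conjugation by it
squeezes the supports of the whole isotopy into the interior of `M × [0, 1]`.
-/

noncomputable section

namespace ClosingClam

section SmoothDependence

open scoped NNReal

variable {E : Type*} [NormedAddCommGroup E] [NormedSpace ℝ E]
  {H : Type*} [TopologicalSpace H] {I : ModelWithCorners ℝ E H}
  {N : Type*} [TopologicalSpace N] [ChartedSpace H N] [IsManifold I ∞ N]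
  {V W : Type*} [NormedAddCommGroup V] [NormedSpace ℝ V] [NormedAddCommGroup W] [NormedSpace ℝ W]

theorem continuous_fderiv_snd {f : N × V → W} (hf : ContMDiff (I.prod 𝓘(ℝ, V)) 𝓘(ℝ, W) ∞ f) :
    Continuous fun p : N × V => fderiv ℝ (fun v => f (p.1, v)) p.2 := by
  rw [continuous_iff_continuousAt]
  intro p
  have hf' : ContMDiff ((I.prod 𝓘(ℝ, V)).prod 𝓘(ℝ, V)) 𝓘(ℝ, W) ∞
      (Function.uncurry fun (q : N × V) v => f (q.1, v)) :=
    hf.comp ((contMDiff_fst.comp contMDiff_fst).prodMk contMDiff_snd)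
  have h := ContMDiffAt.mfderiv (m := 0) (fun (q : N × V) v => f (q.1, v)) Prod.snd
    (hf' (p, p.2)) contMDiffAt_snd (by simp)
  simp only [mfderiv_eq_fderiv] at h
  exact (inTangentCoordinates_model_space (I := 𝓘(ℝ, V)) (I' := 𝓘(ℝ, W)) _ _ _ p ▸ h).continuousAt

theorem exists_lipschitzOnWith_snd {f : N × V → W}
    (hf : ContMDiff (I.prod 𝓘(ℝ, V)) 𝓘(ℝ, W) ∞ f) {K : Set N} (hK : IsCompact K) {s : Set V}
    (hs : IsCompact s) (hsc : Convex ℝ s) :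
    ∃ C : ℝ≥0, ∀ q ∈ K, LipschitzOnWith C (fun v => f (q, v)) s := by
  obtain ⟨C, hC⟩ := (hK.prod hs).exists_bound_of_continuousOn
    (continuous_fderiv_snd hf).continuousOn
  have hdiff (q : N) : Differentiable ℝ fun v => f (q, v) :=
    (hf.comp (contMDiff_const.prodMk contMDiff_id)).contDiff.differentiable (by simp)
  exact ⟨C.toNNReal, fun q hq => hsc.lipschitzOnWith_of_nnnorm_fderiv_le
    (fun v _ => hdiff q v) fun v hv => NNReal.le_toNNReal_of_coe_le (hC (q, v) ⟨hq, hv⟩)⟩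

theorem contDiffAt_comp_extChartAt_symm [I.Boundaryless] {f : N × V → W} {q : N} {v : V}
    (hf : ContMDiffAt (I.prod 𝓘(ℝ, V)) 𝓘(ℝ, W) ∞ f (q, v)) :
    ContDiffAt ℝ ∞ (fun p : E × V => f ((extChartAt I q).symm p.1, p.2))
      (extChartAt I q q, v) := by
  rw [← contMDiffAt_iff_contDiffAt]
  have hsymm : ContMDiffAt 𝓘(ℝ, E) I ∞ (extChartAt I q).symm (extChartAt I q q) :=
    (contMDiffOn_extChartAt_symm q).contMDiffAt (extChartAt_target_mem_nhds q)
  have hfst : ContMDiffAt 𝓘(ℝ, E × V) I ∞ (fun p : E × V => (extChartAt I q).symm p.1)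
      (extChartAt I q q, v) :=
    ContMDiffAt.comp (extChartAt I q q, v) (g := (extChartAt I q).symm) hsymm
      contDiff_fst.contMDiff.contMDiffAt
  exact ContMDiffAt.comp_of_eq (g := f) hf
    (hfst.prodMk contDiff_snd.contMDiff.contMDiffAt) (by simp)

theorem contMDiffAt_of_eq_zero_iff [I.Boundaryless] [CompleteSpace E]
    [CompleteSpace V] {f : N × V → V} {u : N → V} {q : N}
    (hf : ContMDiffAt (I.prod 𝓘(ℝ, V)) 𝓘(ℝ, V) ∞ f (q, u q))
    (hinv : (fderiv ℝ (fun v => f (q, v)) (u q)).IsInvertible)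
    (hu : ∀ q v, f (q, v) = 0 ↔ v = u q) : ContMDiffAt I 𝓘(ℝ, V) ∞ u q := by
  set G : E × V → V := fun p => f ((extChartAt I q).symm p.1, p.2) with hG
  have hcd : ContDiffAt ℝ ∞ G (extChartAt I q q, u q) := contDiffAt_comp_extChartAt_symm hf
  have hpartial : fderiv ℝ G (extChartAt I q q, u q) ∘L .inr ℝ E V =
      fderiv ℝ (fun v => f (q, v)) (u q) := by
    have h := ((hcd.differentiableAt (by simp)).hasFDerivAt.comp (u q)
      (hasFDerivAt_prodMk_right (𝕜 := ℝ) (extChartAt I q q) (u q))).fderiv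
    rw [← h]
    congr 1
    ext v
    simp [hG]
  rw [← hpartial] at hinv
  have hsolves : ∀ᶠ q' in 𝓝 q,
      u q' = hcd.implicitFunction (by simp) hinv (extChartAt I q q') := by
    have h := hcd.eventually_apply_implicitFunction (by simp) hinv
    filter_upwards [(continuousAt_extChartAt (I := I) q).eventually h,
      extChartAt_source_mem_nhds (I := I) q] with q' hq' hsource
    simp only [hG, (extChartAt I q).left_inv hsource, extChartAt_to_inv, (hu q _).2 rfl] at hq'
    exact ((hu _ _).1 hq').symm
  exact ((hcd.contDiffAt_implicitFunction (by simp) hinv).contMDiffAt.comp q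
    contMDiffAt_extChartAt).congr_of_eventuallyEq hsolves

theorem isInvertible_id_sub [CompleteSpace V] {A : V →L[ℝ] V} (hA : ‖A‖ < 1) :
    (ContinuousLinearMap.id ℝ V - A).IsInvertible :=
  ⟨ContinuousLinearEquiv.ofUnit (Units.oneSub A hA), rfl⟩

theorem exists_contMDiff_fixedPoint [I.Boundaryless] [CompleteSpace E] [CompleteSpace V]
    {f : N × V → V} (hf : ContMDiff (I.prod 𝓘(ℝ, V)) 𝓘(ℝ, V) ∞ f) {c : ℝ≥0}
    (hlip : ∀ q, ContractingWith c fun v => f (q, v)) :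
    ∃ u : N → V, ContMDiff I 𝓘(ℝ, V) ∞ u ∧ ∀ q v, f (q, v) = v ↔ v = u q := by
  let u q := ContractingWith.fixedPoint _ (hlip q)
  have hu q v : f (q, v) = v ↔ v = u q :=
    ⟨fun h => (hlip q).fixedPoint_unique h, fun h => h ▸ (hlip q).fixedPoint_isFixedPt⟩
  refine ⟨u, fun q => ?_, hu⟩
  have hdiff : DifferentiableAt ℝ (fun v => f (q, v)) (u q) :=
    (hf.comp (contMDiff_const.prodMk contMDiff_id)).contDiff.differentiable (by simp) _
  refine contMDiffAt_of_eq_zero_iff (f := fun p => p.2 - f p)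
    (contMDiff_snd.sub hf _) ?_ fun q v => by rw [sub_eq_zero, eq_comm, hu]
  rw [fderiv_fun_sub differentiableAt_fun_id hdiff, fderiv_fun_id]
  exact isInvertible_id_sub
    ((norm_fderiv_le_of_lipschitz ℝ (hlip q).2).trans_lt (by exact_mod_cast (hlip q).1))

end SmoothDependence

section Twist

open Real (smoothTransition)
open scoped NNReal

theorem lipschitzWith_of_apply_projIcc {α : Type*} [PseudoEMetricSpace α] {a b : ℝ} (hab : a ≤ b)
    {f : ℝ → α} {C : ℝ≥0} (hC : LipschitzOnWith C f (Set.Icc a b))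
    (hf : ∀ u, f (Set.projIcc a b hab u) = f u) : LipschitzWith C f := fun u v => by
  rw [← hf u, ← hf v]
  refine (hC (Set.projIcc a b hab u).2 (Set.projIcc a b hab v).2).trans ?_
  gcongr
  exact (LipschitzWith.projIcc hab u v).trans_eq (one_mul _)

theorem exists_lipschitzWith_smoothTransition : ∃ C : ℝ≥0, LipschitzWith C smoothTransition := by
  obtain ⟨C, hC⟩ := (Real.smoothTransition.contDiff (n := 1)).contDiffOn.exists_lipschitzOnWith
    one_ne_zero (convex_Icc (0 : ℝ) 1) isCompact_Icc
  exact ⟨C, lipschitzWith_of_apply_projIcc zero_le_one hC fun _ => Real.smoothTransition.projIcc⟩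

/-- Smooth time in `[0,1]`, constant on `(-∞, 0]` and on `[1, ∞)`; it turns a family indexed by
`[0,1]` into a smooth one indexed by `ℝ`. -/
def smoothTime (u : ℝ) : unitInterval :=
  ⟨smoothTransition u, Real.smoothTransition.nonneg u, Real.smoothTransition.le_one u⟩

theorem contMDiff_smoothTime : ContMDiff 𝓘(ℝ, ℝ) (𝓡∂ 1) ∞ smoothTime :=
  contMDiff_iff_comp_subtypeVal_Icc.2
    ⟨Real.smoothTransition.continuous.subtype_mk _,
      (Real.smoothTransition.contDiff (n := ⊤)).contMDiff⟩

@[simp] theorem smoothTime_zero : smoothTime 0 = 0 := Subtype.ext Real.smoothTransition.zero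

@[simp] theorem smoothTime_one : smoothTime 1 = 1 := Subtype.ext Real.smoothTransition.one

theorem smoothTime_projIcc (u : ℝ) : smoothTime (Set.projIcc 0 1 zero_le_one u) = smoothTime u :=
  Subtype.ext Real.smoothTransition.projIcc

variable {E : Type*} [NormedAddCommGroup E] [NormedSpace ℝ E]
  {H : Type*} [TopologicalSpace H] {I : ModelWithCorners ℝ E H}
  {N : Type*} [TopologicalSpace N] [ChartedSpace H N]

theorem exists_isIsotopy_of_inverse {F K : unitInterval × N → N}
    (hF : ContMDiff ((𝓡∂ 1).prod I) I ∞ F) (hK : ContMDiff ((𝓡∂ 1).prod I) I ∞ K)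
    (hKF : ∀ t p, K (t, F (t, p)) = p) (hFK : ∀ t p, F (t, K (t, p)) = p) :
    ∃ h : unitInterval → Diff I N, IsIsotopy h ∧ ∀ t p, h t p = F (t, p) :=
  ⟨fun t =>
    { toFun := fun p => F (t, p)
      invFun := fun p => K (t, p)
      left_inv := hKF t
      right_inv := hFK t
      contMDiff_toFun := hF.comp (contMDiff_const.prodMk contMDiff_id)
      contMDiff_invFun := hK.comp (contMDiff_const.prodMk contMDiff_id) },
    ⟨hF, hK⟩, fun _ _ => rfl⟩

/-- The inverse sends `q` to `h_u⁻¹ q`, where the time `u` is the fixed point of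
`u ↦ ρ (h_u⁻¹ q)`. -/
theorem exists_isIsotopy_twist [I.Boundaryless] [CompleteSpace E] [IsManifold I ∞ N]
    {h : unitInterval → Diff I N} (hh : IsIsotopy h) {ρ : N → ℝ}
    (hρ : ContMDiff I 𝓘(ℝ, ℝ) ∞ ρ) {c : ℝ≥0}
    (hlip : ∀ q, ContractingWith c fun u : ℝ => ρ ((h (smoothTime u))⁻¹ q)) :
    ∃ P : unitInterval → Diff I N, IsIsotopy P ∧
      ∀ t p, P t p = h (smoothTime (smoothTime t * ρ p)) p := by
  have hslow (r : ℝ) (q : N) :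
      ContractingWith c fun u : ℝ => (smoothTime r : ℝ) * ρ ((h (smoothTime u))⁻¹ q) :=
    ⟨(hlip q).1, LipschitzWith.of_dist_le_mul fun u v => by
      rw [dist_eq_norm, ← mul_sub, norm_mul, ← dist_eq_norm]
      refine (mul_le_of_le_one_left dist_nonneg ?_).trans ((hlip q).2.dist_le_mul u v)
      rw [Real.norm_of_nonneg (smoothTime r).2.1]
      exact (smoothTime r).2.2⟩
  have htime : ContMDiff 𝓘(ℝ, ℝ) 𝓘(ℝ, ℝ) ∞ fun r => (smoothTime r : ℝ) :=
    Real.smoothTransition.contDiff.contMDiff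
  have hback : ContMDiff (I.prod 𝓘(ℝ, ℝ)) I ∞
      (fun p : N × ℝ => (h (smoothTime p.2))⁻¹ p.1) :=
    hh.2.comp ((contMDiff_smoothTime.comp contMDiff_snd).prodMk contMDiff_fst)
  obtain ⟨u, hu, hfix⟩ := exists_contMDiff_fixedPoint (I := 𝓘(ℝ, ℝ).prod I) (N := ℝ × N)
    (f := fun p => (smoothTime p.1.1 : ℝ) * ρ ((h (smoothTime p.2))⁻¹ p.1.2))
    ((htime.comp (contMDiff_fst.comp contMDiff_fst)).mul (hρ.comp (hback.comp
      ((contMDiff_snd.comp contMDiff_fst).prodMk contMDiff_snd)))) fun q => hslow q.1 q.2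
  have hcoe : ContMDiff ((𝓡∂ 1).prod I) (𝓘(ℝ, ℝ).prod I) ∞
      (fun p : unitInterval × N => ((p.1 : ℝ), p.2)) :=
    (contMDiff_subtypeVal_Icc.comp contMDiff_fst).prodMk contMDiff_snd
  refine exists_isIsotopy_of_inverse
    (F := fun p => h (smoothTime (smoothTime p.1 * ρ p.2)) p.2)
    (K := fun p => (h (smoothTime (u (p.1, p.2))))⁻¹ p.2)
    (hh.1.comp ((contMDiff_smoothTime.comp (((htime.comp contMDiff_subtypeVal_Icc).comp
      contMDiff_fst).mul (hρ.comp contMDiff_snd))).prodMk contMDiff_snd))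
    (hback.comp (contMDiff_snd.prodMk (hu.comp hcoe))) (fun t p => ?_) fun t q => ?_
  · have htime_eq := (hfix (t, h (smoothTime (smoothTime t * ρ p)) p) (smoothTime t * ρ p)).1
      (by simp)
    simp only [← htime_eq, inv_apply_self]
  · have htime_eq := (hfix (t, q) _).2 rfl
    simp only at htime_eq ⊢
    rw [htime_eq, apply_inv_self]

end Twist

section Line

open Real (smoothTransition)
open Filter
open scoped NNReal

theorem surjective_add_of_monotone {m : ℝ → ℝ} (hm : Continuous m) (hmono : Monotone m) :
    Function.Surjective fun s => s + m s := by
  refine (continuous_id.add hm).surjective ?_ ?_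
  · refine tendsto_atTop_mono' _ ?_ (tendsto_atTop_add_const_right atTop (m 0) tendsto_id)
    filter_upwards [eventually_ge_atTop 0] with s hs
    exact add_le_add_right (hmono hs) s
  · refine tendsto_atBot_mono' _ ?_ (tendsto_atBot_add_const_right atBot (m 0) tendsto_id)
    filter_upwards [eventually_le_atBot 0] with s hs
    exact add_le_add_right (hmono hs) s

theorem exists_diff_eq_add_of_monotone {m : ℝ → ℝ} (hm : ContDiff ℝ ∞ m) (hmono : Monotone m) :
    ∃ σ : Diff 𝓘(ℝ, ℝ) ℝ, ∀ s, σ s = s + m s := by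
  let f : ℝ ≃ₜ ℝ := (StrictMono.orderIsoOfSurjective (fun s => s + m s)
    (strictMono_id.add_monotone hmono)
    (surjective_add_of_monotone hm.continuous hmono)).toHomeomorph
  have hf : ContDiff ℝ ∞ f := contDiff_id.add hm
  have hderiv s : HasDerivAt f (1 + deriv m s) s :=
    (hasDerivAt_id s).add (hm.differentiable (by simp) s).hasDerivAt
  have hpos s : 1 + deriv m s ≠ 0 := (add_pos_of_pos_of_nonneg one_pos hmono.deriv_nonneg).ne'
  exact ⟨⟨f.toEquiv, hf.contMDiff, (f.contDiff_symm_deriv hpos hderiv hf).contMDiff⟩, fun _ => rfl⟩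

/-- A smooth monotone step from `0` on `(-∞, a]` to `1` on `[b, ∞)`, for `a < b`. -/
def smoothStep (a b s : ℝ) : ℝ := smoothTransition ((s - a) / (b - a))

theorem contDiff_smoothStep (a b : ℝ) : ContDiff ℝ ∞ (smoothStep a b) :=
  Real.smoothTransition.contDiff.comp ((contDiff_id.sub contDiff_const).div_const _)

theorem smoothStep_mem_Icc (a b s : ℝ) : smoothStep a b s ∈ Set.Icc 0 1 :=
  ⟨Real.smoothTransition.nonneg _, Real.smoothTransition.le_one _⟩

theorem monotone_smoothStep {a b : ℝ} (hab : a ≤ b) : Monotone (smoothStep a b) := fun _ _ hst =>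
  Real.smoothTransition.monotone
    (div_le_div_of_nonneg_right (sub_le_sub_right hst a) (sub_nonneg.2 hab))

theorem smoothStep_of_le {a b s : ℝ} (hab : a ≤ b) (hs : s ≤ a) : smoothStep a b s = 0 :=
  Real.smoothTransition.zero_of_nonpos
    (div_nonpos_of_nonpos_of_nonneg (sub_nonpos.2 hs) (sub_nonneg.2 hab))

theorem smoothStep_of_ge {a b s : ℝ} (hab : a < b) (hs : b ≤ s) : smoothStep a b s = 1 :=
  Real.smoothTransition.one_of_one_le ((one_le_div (sub_pos.2 hab)).2 (sub_le_sub_right hs a))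

theorem exists_lipschitzWith_smoothStep {c : ℝ≥0} (hc : 0 < c) (b : ℝ) :
    ∃ a < b, LipschitzWith c (smoothStep a b) := by
  obtain ⟨C, hC⟩ := exists_lipschitzWith_smoothTransition
  have hwidth : 0 < C / c + 1 := by positivity
  refine ⟨b - (C / c + 1 : ℝ≥0), sub_lt_self b hwidth, LipschitzWith.of_dist_le_mul fun s t => ?_⟩
  refine (hC.dist_le_mul _ _).trans ?_
  rw [sub_sub_cancel, Real.dist_eq, ← sub_div, sub_sub_sub_cancel_right, abs_div,
    abs_of_pos (NNReal.coe_pos.2 hwidth), ← Real.dist_eq, mul_div_assoc',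
    div_le_iff₀ (NNReal.coe_pos.2 hwidth), mul_right_comm]
  gcongr
  push_cast
  rw [mul_add, mul_div_cancel₀ _ (NNReal.coe_pos.2 hc).ne']
  linarith [c.2]

/-- `σ` shifts `[ε, ∞)` up by `1` and fixes `(-∞, 0]`, and so opens a gap of length `1` in `ℝ`. -/
structure IsGap (ε : ℝ) (σ : Diff 𝓘(ℝ, ℝ) ℝ) : Prop where
  apply_of_nonpos : ∀ s ≤ 0, σ s = s
  apply_of_le : ∀ s, ε ≤ s → σ s = s + 1
  apply_mem_Icc : ∀ s, σ s ∈ Set.Icc s (s + 1)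

theorem exists_isGap {ε : ℝ} (hε : 0 < ε) : ∃ σ : Diff 𝓘(ℝ, ℝ) ℝ, IsGap ε σ := by
  obtain ⟨σ, hσ⟩ := exists_diff_eq_add_of_monotone (contDiff_smoothStep 0 ε)
    (monotone_smoothStep hε.le)
  refine ⟨σ, fun s hs => ?_, fun s hs => ?_, fun s => ?_⟩
  · rw [hσ, smoothStep_of_le hε.le hs, add_zero]
  · rw [hσ, smoothStep_of_ge hε hs]
  · rw [hσ]
    exact ⟨le_add_of_nonneg_right (smoothStep_mem_Icc _ _ _).1,
      add_le_add_right (smoothStep_mem_Icc _ _ _).2 s⟩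

theorem exists_diff_stretch {a' a b b' : ℝ} (ha : a' < a) (hab : a ≤ b) (hb : b < b') (L : ℝ) :
    ∃ φ : Diff 𝓘(ℝ, ℝ) ℝ, (∀ s ∈ Set.Icc a b, φ s = s) ∧
      ∀ s ∉ Set.Icc a' b', φ s ∉ Set.Icc (-L) L := by
  let B := |L| + |a'| + |b'|
  have hmono : Monotone fun s => B * (smoothStep a' a s - 1 + smoothStep b b' s) :=
    (((monotone_smoothStep ha.le).add_const _).add (monotone_smoothStep hb.le)).const_mul
      (by positivity)
  obtain ⟨φ, hφ⟩ := exists_diff_eq_add_of_monotone (contDiff_const.mul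
    (((contDiff_smoothStep a' a).sub contDiff_const).add (contDiff_smoothStep b b'))) hmono
  refine ⟨φ, fun s hs => ?_, fun s hs hmem => ?_⟩
  · rw [hφ, smoothStep_of_ge ha hs.1, smoothStep_of_le hb.le hs.2]
    ring
  · rw [hφ, Set.mem_Icc] at hmem
    rw [Set.mem_Icc, not_and_or, not_le, not_le] at hs
    rcases hs with hs | hs
    · rw [smoothStep_of_le ha.le hs.le, smoothStep_of_le hb.le (by linarith)] at hmem
      linarith [le_abs_self L, le_abs_self a', abs_nonneg b']
    · rw [smoothStep_of_ge ha (by linarith), smoothStep_of_ge hb hs.le] at hmem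
      linarith [le_abs_self L, neg_abs_le b', abs_nonneg a']

end Line

section Cylinder

open scoped NNReal commutatorElement

variable {E : Type*} [NormedAddCommGroup E] [NormedSpace ℝ E]
  {H : Type*} [TopologicalSpace H] {I : ModelWithCorners ℝ E H}
  {M : Type*} [TopologicalSpace M] [ChartedSpace H M]

theorem commute_of_forall_eq_or_eq {φ ψ : Diff I M} (h : ∀ p, φ p = p ∨ ψ p = p) :
    Commute φ ψ :=
  Diffeomorph.toEquiv_injective
    (Equiv.Perm.Disjoint.commute (f := φ.toEquiv) (g := ψ.toEquiv) h)

variable (I M) in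
/-- The vertical diffeomorphism `(x, s) ↦ (x, σ s)` of `M × ℝ` given by a diffeomorphism `σ` of
`ℝ`. -/
def vertical : Diff 𝓘(ℝ, ℝ) ℝ →* Diff (I.prod 𝓘(ℝ, ℝ)) (M × ℝ) where
  toFun σ := Diffeomorph.prodCongr 1 σ
  map_one' := rfl
  map_mul' _ _ := rfl

@[simp] theorem vertical_apply (σ : Diff 𝓘(ℝ, ℝ) ℝ) (p : M × ℝ) :
    vertical I M σ p = (p.1, σ p.2) := rfl

variable (I M) in
/-- The diffeomorphisms of `M × ℝ` that commute with the translations by integers, that is, the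
lifts of self-diffeomorphisms of the quotient `M × ℝ/ℤ`. -/
def periodicDiff : Subgroup (Diff (I.prod 𝓘(ℝ, ℝ)) (M × ℝ)) where
  carrier := {φ | ∀ (x : M) (s : ℝ) (m : ℤ), φ (x, s + m) = ((φ (x, s)).1, (φ (x, s)).2 + m)}
  one_mem' _ _ _ := rfl
  mul_mem' hφ hψ x s m := by simp only [mul_apply, hψ x s m, hφ _ _ m, Prod.mk.eta]
  inv_mem' {φ} hφ x s m := φ.injective <| by
    change φ (φ⁻¹ (x, s + m)) = φ ((φ⁻¹ (x, s)).1, (φ⁻¹ (x, s)).2 + m)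
    rw [apply_inv_self, hφ, Prod.mk.eta, apply_inv_self]

theorem mem_periodicDiff {φ : Diff (I.prod 𝓘(ℝ, ℝ)) (M × ℝ)} : φ ∈ periodicDiff I M ↔
    ∀ (x : M) (s : ℝ) (m : ℤ), φ (x, s + m) = ((φ (x, s)).1, (φ (x, s)).2 + m) := Iff.rfl

theorem exists_lipschitzWith_height [IsManifold I ∞ M] [CompactSpace M]
    {h : unitInterval → Diff (I.prod 𝓘(ℝ, ℝ)) (M × ℝ)} (hh : IsIsotopy h)
    (hper : ∀ t, h t ∈ periodicDiff I M) :
    ∃ C : ℝ≥0, ∀ p, LipschitzWith C fun u : ℝ => (h (smoothTime u) p).2 := by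
  have hsmooth : ContMDiff ((I.prod 𝓘(ℝ, ℝ)).prod 𝓘(ℝ, ℝ)) 𝓘(ℝ, ℝ) ∞
      fun q : (M × ℝ) × ℝ => (h (smoothTime q.2) q.1).2 :=
    contMDiff_snd.comp
      (hh.1.comp ((contMDiff_smoothTime.comp contMDiff_snd).prodMk contMDiff_fst))
  obtain ⟨C, hC⟩ := exists_lipschitzOnWith_snd hsmooth
    (isCompact_univ.prod (isCompact_Icc (a := (0 : ℝ)) (b := 1))) isCompact_Icc
    (convex_Icc (0 : ℝ) 1)
  refine ⟨C, fun ⟨x, s⟩ => LipschitzWith.of_dist_le_mul fun u v => ?_⟩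
  have hlip := lipschitzWith_of_apply_projIcc zero_le_one
    (hC (x, Int.fract s) ⟨trivial, Int.fract_nonneg s, (Int.fract_lt_one s).le⟩)
    fun u => by rw [smoothTime_projIcc]
  have hshift u : (h (smoothTime u) (x, s)).2 = (h (smoothTime u) (x, Int.fract s)).2 + ⌊s⌋ := by
    have hfract := mem_periodicDiff.1 (hper (smoothTime u)) x (Int.fract s) ⌊s⌋
    rw [Int.fract_add_floor] at hfract
    rw [hfract]
  simpa only [hshift, dist_add_right] using hlip.dist_le_mul u v

theorem dist_height_le {h : unitInterval → Diff (I.prod 𝓘(ℝ, ℝ)) (M × ℝ)} (h0 : h 0 = 1) {C : ℝ≥0}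
    (hC : ∀ p, LipschitzWith C fun u : ℝ => (h (smoothTime u) p).2) {u : ℝ}
    (hu : u ∈ Set.Icc 0 1) (p : M × ℝ) : dist (h (smoothTime u) p).2 p.2 ≤ C := by
  have hlip := (hC p).dist_le_mul u 0
  rw [smoothTime_zero, h0, one_apply, dist_zero_right, Real.norm_of_nonneg hu.1] at hlip
  exact hlip.trans (mul_le_of_le_one_right C.2 hu.2)

theorem height_nonneg_iff {φ : Diff (I.prod 𝓘(ℝ, ℝ)) (M × ℝ)} (hφ : φ ∈ periodicDiff I M)
    (hmap : ∀ p : M × ℝ, p.2 ∈ Set.Icc 0 1 → 0 ≤ (φ p).2)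
    (hmap_inv : ∀ p : M × ℝ, p.2 ∈ Set.Icc 0 1 → 0 ≤ (φ⁻¹ p).2) (p : M × ℝ) :
    0 ≤ (φ p).2 ↔ 0 ≤ p.2 := by
  have hnonneg {ψ : Diff (I.prod 𝓘(ℝ, ℝ)) (M × ℝ)} (hψ : ψ ∈ periodicDiff I M)
      (hmap : ∀ p : M × ℝ, p.2 ∈ Set.Icc 0 1 → 0 ≤ (ψ p).2) {p : M × ℝ} (hp : 0 ≤ p.2) :
      0 ≤ (ψ p).2 := by
    have hfract := mem_periodicDiff.1 hψ p.1 (Int.fract p.2) ⌊p.2⌋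
    rw [Int.fract_add_floor] at hfract
    rw [← Prod.mk.eta (p := p), hfract]
    exact add_nonneg (hmap _ ⟨Int.fract_nonneg _, (Int.fract_lt_one _).le⟩)
      (Int.cast_nonneg (Int.floor_nonneg.2 hp))
  refine ⟨fun hp => ?_, hnonneg hφ hmap⟩
  simpa only [inv_apply_self] using hnonneg (inv_mem hφ) hmap_inv hp

/-- A diffeomorphism of `M × ℝ` that is the identity below height `-D`, commutes with the unit
translation above height `0`, and moves no point by more than `D` vertically. -/
structure IsHalfPeriodic (D : ℝ) (φ : Diff (I.prod 𝓘(ℝ, ℝ)) (M × ℝ)) : Prop where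
  apply_of_le : ∀ p : M × ℝ, p.2 ≤ -D → φ p = p
  apply_add_one : ∀ x s, 0 ≤ s → φ (x, s + 1) = ((φ (x, s)).1, (φ (x, s)).2 + 1)
  dist_height_le : ∀ p, dist (φ p).2 p.2 ≤ D

theorem exists_isIsotopy_isHalfPeriodic [I.Boundaryless] [CompleteSpace E] [IsManifold I ∞ M]
    [CompactSpace M] {h : unitInterval → Diff (I.prod 𝓘(ℝ, ℝ)) (M × ℝ)} (hh : IsIsotopy h)
    (h0 : h 0 = 1) (hper : ∀ t, h t ∈ periodicDiff I M) :
    ∃ P : unitInterval → Diff (I.prod 𝓘(ℝ, ℝ)) (M × ℝ), IsIsotopy P ∧ P 0 = 1 ∧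
      (∀ p, 0 ≤ p.2 → P 1 p = h 1 p) ∧ ∃ D, ∀ t, IsHalfPeriodic D (P t) := by
  obtain ⟨C, hC⟩ := exists_lipschitzWith_height hh hper
  obtain ⟨C', hC'⟩ := exists_lipschitzWith_height hh.inv fun t => inv_mem (hper t)
  obtain ⟨a, ha, hstep⟩ := exists_lipschitzWith_smoothStep (c := (C' + 1)⁻¹) (by positivity) 0
  obtain ⟨P, hP, hP_apply⟩ := exists_isIsotopy_twist (c := (C' + 1)⁻¹ * C') hh
    (ρ := fun p => smoothStep a 0 p.2) ((contDiff_smoothStep a 0).contMDiff.comp contMDiff_snd)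
    fun q => ⟨by
      rw [← div_eq_inv_mul, div_lt_one (by positivity)]
      exact lt_add_one C', hstep.comp (hC' q)⟩
  have htime (t : unitInterval) (p : M × ℝ) :
      (smoothTime t : ℝ) * smoothStep a 0 p.2 ∈ Set.Icc 0 1 :=
    unitInterval.mul_mem (smoothTime t).2 (smoothStep_mem_Icc _ _ _)
  refine ⟨P, hP, Diffeomorph.ext fun p => ?_, fun p hp => ?_, max C (-a), fun t =>
    ⟨fun p hp => ?_, fun x s hs => ?_, fun p => ?_⟩⟩
  · rw [hP_apply, Set.Icc.coe_zero, smoothTime_zero, Set.Icc.coe_zero, zero_mul, smoothTime_zero,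
      h0]
  · rw [hP_apply, smoothStep_of_ge ha hp, Set.Icc.coe_one, smoothTime_one, Set.Icc.coe_one,
      mul_one, smoothTime_one]
  · rw [hP_apply, smoothStep_of_le ha.le (hp.trans (neg_le.1 (le_max_right _ _))), mul_zero,
      smoothTime_zero, h0, one_apply]
  · rw [hP_apply, hP_apply, smoothStep_of_ge ha hs, smoothStep_of_ge ha (by positivity)]
    exact_mod_cast mem_periodicDiff.1 (hper _) x s 1
  · rw [hP_apply]
    exact (dist_height_le h0 hC (htime t p) p).trans (le_max_left _ _)

theorem commutatorElement_apply_apply (φ ψ : Diff I M) (w : M) :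
    ⁅φ, ψ⁆ (ψ (φ w)) = φ (ψ w) := by
  simp only [commutatorElement_def, mul_apply, inv_apply_self]

theorem IsHalfPeriodic.commutator_apply_of_notMem_Icc {D ε : ℝ} (hε : 0 < ε)
    {φ : Diff (I.prod 𝓘(ℝ, ℝ)) (M × ℝ)} (hφ : IsHalfPeriodic D φ) {σ : Diff 𝓘(ℝ, ℝ) ℝ}
    (hσ : IsGap ε σ) {p : M × ℝ} (hp : p.2 ∉ Set.Icc (-(D + ε + 1)) (D + ε + 1)) :
    ⁅φ, vertical I M σ⁆ p = p := by
  have hD : 0 ≤ D := dist_nonneg.trans (hφ.dist_height_le p)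
  suffices ∃ w, φ (vertical I M σ w) = p ∧ vertical I M σ (φ w) = p by
    obtain ⟨w, hw, hw'⟩ := this
    simpa only [hw, hw'] using commutatorElement_apply_apply φ (vertical I M σ) w
  obtain ⟨x, s⟩ := p
  rw [Set.mem_Icc, not_and_or, not_le, not_le] at hp
  rcases hp with hs | hs
  · have hφp : φ (x, s) = (x, s) := hφ.apply_of_le _ (by linarith)
    have hσp : vertical I M σ (x, s) = (x, s) := by
      rw [vertical_apply, hσ.apply_of_nonpos s (by linarith)]
    exact ⟨(x, s), by rw [hσp, hφp], by rw [hφp, hσp]⟩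
  · have hdist := hφ.dist_height_le (φ⁻¹ (x, s - 1))
    rw [apply_inv_self, Real.dist_eq, abs_le] at hdist
    refine ⟨φ⁻¹ (x, s - 1), ?_, ?_⟩
    · rw [vertical_apply, hσ.apply_of_le _ (by linarith), hφ.apply_add_one _ _ (by linarith),
        Prod.mk.eta, apply_inv_self, sub_add_cancel]
    · rw [apply_inv_self, vertical_apply, hσ.apply_of_le _ (by linarith), sub_add_cancel]

theorem IsHalfPeriodic.commutator_apply {D ε : ℝ} (hε : 0 ≤ ε)
    {φ : Diff (I.prod 𝓘(ℝ, ℝ)) (M × ℝ)} (hφ : IsHalfPeriodic D φ)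
    (hfix : ∀ p, p.2 ∈ Set.Icc 0 ε → φ p = p) (hnonneg : ∀ p, 0 ≤ (φ p).2 ↔ 0 ≤ p.2)
    {σ : Diff 𝓘(ℝ, ℝ) ℝ} (hσ : IsGap ε σ) (p : M × ℝ) :
    ⁅φ, vertical I M σ⁆ p = if p.2 ∈ Set.Icc 0 1 then φ p else p := by
  obtain ⟨w, rfl⟩ : ∃ w, vertical I M σ (φ w) = p :=
    ⟨φ⁻¹ ((vertical I M σ)⁻¹ p), by simp only [apply_inv_self]⟩
  rw [commutatorElement_apply_apply]
  rcases lt_or_ge w.2 0 with hw | hw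
  · have hφw : (φ w).2 < 0 := not_le.1 fun hle => hw.not_ge ((hnonneg w).1 hle)
    simp only [vertical_apply, hσ.apply_of_nonpos _ hw.le, hσ.apply_of_nonpos _ hφw.le]
    exact (if_neg fun hmem => hφw.not_ge hmem.1).symm
  rcases le_or_gt w.2 ε with hwε | hwε
  · rw [hfix w ⟨hw, hwε⟩]
    split_ifs with hmem
    · rfl
    · have hσw := hσ.apply_mem_Icc w.2
      have hgt : 1 < σ w.2 := not_le.1 fun hle => hmem ⟨hw.trans hσw.1, hle⟩
      have hpred : φ (w.1, σ w.2 - 1) = (w.1, σ w.2 - 1) :=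
        hfix _ ⟨by linarith, by linarith [hσw.2]⟩
      have hsucc := hφ.apply_add_one w.1 (σ w.2 - 1) (by linarith)
      rwa [hpred, sub_add_cancel] at hsucc
  · have hφw : ε < (φ w).2 := not_le.1 fun hle =>
      hwε.not_ge (φ.injective (hfix (φ w) ⟨(hnonneg w).2 hw, hle⟩) ▸ hle)
    simp only [vertical_apply, hσ.apply_of_le _ hwε.le, hσ.apply_of_le _ hφw.le]
    rw [if_neg fun hmem => by linarith [hmem.2], hφ.apply_add_one _ _ hw]

theorem exists_isIsotopy_eq_self_of_notMem_Icc [I.Boundaryless] [CompleteSpace E]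
    [IsManifold I ∞ M] [CompactSpace M] {h : unitInterval → Diff (I.prod 𝓘(ℝ, ℝ)) (M × ℝ)}
    (hh : IsIsotopy h) (h0 : h 0 = 1) (hper : ∀ t, h t ∈ periodicDiff I M) {ε : ℝ} (hε : 0 < ε)
    (hε_le : ε ≤ 1 / 2)
    (hfix : ∀ p, p.2 ∈ Set.Icc 0 1 → p.2 ∉ Set.Ioo ε (1 - ε) → h 1 p = p)
    (hnonneg : ∀ p, 0 ≤ (h 1 p).2 ↔ 0 ≤ p.2) :
    ∃ R : unitInterval → Diff (I.prod 𝓘(ℝ, ℝ)) (M × ℝ), IsIsotopy R ∧ R 0 = 1 ∧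
      (∀ t p, p.2 ∉ Set.Icc (ε / 2) (1 - ε / 2) → R t p = p) ∧
      ∀ p, p.2 ∈ Set.Icc 0 1 → R 1 p = h 1 p := by
  obtain ⟨P, hP, hP0, hP1, D, hPD⟩ := exists_isIsotopy_isHalfPeriodic hh h0 hper
  obtain ⟨σ, hσ⟩ := exists_isGap hε
  obtain ⟨τ, hτ_fix, hτ_out⟩ := exists_diff_stretch (half_lt_self hε)
    (by linarith : ε ≤ 1 - ε) (by linarith : 1 - ε < 1 - ε / 2) (D + ε + 1)
  have hP1_nonneg p : 0 ≤ (P 1 p).2 ↔ 0 ≤ p.2 := by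
    refine ⟨fun hp => ?_, fun hp => by rwa [hP1 p hp, hnonneg]⟩
    obtain ⟨q, hq⟩ : ∃ q, h 1 q = P 1 p := ⟨(h 1)⁻¹ (P 1 p), apply_inv_self _ _⟩
    have hq_nonneg : 0 ≤ q.2 := (hnonneg q).1 (hq ▸ hp)
    rwa [← (P 1).injective ((hP1 q hq_nonneg).trans hq)]
  have hcomm := (hPD 1).commutator_apply hε.le
    (fun p hp => (hP1 p hp.1).trans
      (hfix p ⟨hp.1, hp.2.trans (by linarith)⟩ fun hmem => hmem.1.not_ge hp.2)) hP1_nonneg hσ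
  have hcommute : Commute ⁅P 1, vertical I M σ⁆ (vertical I M τ) :=
    commute_of_forall_eq_or_eq fun p => or_iff_not_imp_right.2 fun hp => by
      rw [hcomm, ite_eq_right_iff]
      intro hmem
      rw [hP1 p hmem.1]
      exact hfix p hmem fun hmid => hp (Prod.ext rfl (hτ_fix _ (Set.Ioo_subset_Icc_self hmid)))
  refine ⟨fun t => (vertical I M τ)⁻¹ * ⁅P t, vertical I M σ⁆ * vertical I M τ, ?_, ?_,
    fun t p hp => ?_, fun p hp => ?_⟩
  · exact (((isIsotopy_const _).mul (((hP.mul (isIsotopy_const _)).mul hP.inv).mul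
      (isIsotopy_const _))).mul (isIsotopy_const _))
  · simp only [hP0, commutatorElement_one_left, mul_one, inv_mul_cancel]
  · simp only [mul_apply]
    rw [(hPD t).commutator_apply_of_notMem_Icc hε hσ (hτ_out _ hp), inv_apply_self]
  · beta_reduce
    rw [hcommute.symm.inv_mul_cancel, hcomm, if_pos hp, hP1 p hp.1]

end Cylinder

section CircleLift

variable {E : Type*} [NormedAddCommGroup E] [NormedSpace ℝ E]
  {H : Type*} [TopologicalSpace H] {I : ModelWithCorners ℝ E H}
  {N : Type*} [TopologicalSpace N] [ChartedSpace H N]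

attribute [local instance] finrank_real_complex_fact' in
theorem contMDiffAt_circleArg {z : Circle} (hz : (z : ℂ) ∈ Complex.slitPlane) :
    ContMDiffAt (𝓡 1) 𝓘(ℝ, ℝ) ∞ (fun w : Circle => Complex.arg w) z := by
  have hcoe : ContMDiff (𝓡 1) 𝓘(ℝ, ℂ) ∞ (fun w : Circle => (w : ℂ)) := contMDiff_coe_sphere
  have hlog : ContDiffAt ℝ ∞ Complex.log z := (Complex.contDiffAt_log hz).restrict_scalars ℝ
  have harg : ContDiffAt ℝ ∞ Complex.arg z :=
    (Complex.imCLM.contDiff.contDiffAt.comp (z : ℂ) hlog).congr_of_eventuallyEq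
      (.of_forall fun w => (Complex.log_im w).symm)
  exact harg.contMDiffAt.comp z hcoe.contMDiffAt

theorem contMDiff_of_circleExp {θ : N → ℝ} (hθ : Continuous θ)
    (h : ContMDiff I (𝓡 1) ∞ fun x => Circle.exp (θ x)) : ContMDiff I 𝓘(ℝ, ℝ) ∞ θ := fun a => by
  have hquot : ContMDiff I (𝓡 1) ∞ fun x => Circle.exp (θ x) / Circle.exp (θ a) :=
    h.div contMDiff_const
  have harg : ContMDiffAt I 𝓘(ℝ, ℝ) ∞
      (fun x => Complex.arg ↑(Circle.exp (θ x) / Circle.exp (θ a))) a :=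
    (contMDiffAt_circleArg (by simp only [div_self', Circle.coe_one, Complex.one_mem_slitPlane])
      ).comp a hquot.contMDiffAt
  refine (harg.add (contMDiffAt_const (c := θ a))).congr_of_eventuallyEq ?_
  filter_upwards [hθ.continuousAt.eventually (Metric.ball_mem_nhds (θ a) Real.pi_pos)] with x hx
  rw [Real.dist_eq, abs_lt] at hx
  change θ x = Complex.arg ↑(Circle.exp (θ x) / Circle.exp (θ a)) + θ a
  rw [← Circle.exp_sub, Circle.arg_exp hx.1 hx.2.le, sub_add_cancel]

/-- The universal covering `ℝ → S¹` with period `1`, which extends `wrap`. -/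
def turn (s : ℝ) : Circle := Circle.exp (2 * Real.pi * s)

theorem turn_add (s t : ℝ) : turn (s + t) = turn s * turn t := by
  rw [turn, mul_add, Circle.exp_add, turn, turn]

theorem turn_sub (s t : ℝ) : turn (s - t) = turn s / turn t := by
  rw [turn, mul_sub, Circle.exp_sub, turn, turn]

theorem turn_intCast (m : ℤ) : turn m = 1 := Circle.exp_two_pi_mul_int m

theorem contMDiff_turn : ContMDiff 𝓘(ℝ, ℝ) (𝓡 1) ∞ turn :=
  contMDiff_circleExp.comp (contDiff_const.mul contDiff_id).contMDiff

theorem turn_eq_turn_iff {s t : ℝ} : turn s = turn t ↔ ∃ m : ℤ, s = t + m := by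
  simp only [turn, Circle.exp_eq_exp, ← mul_comm (2 * Real.pi), ← mul_add,
    mul_right_inj' Real.two_pi_pos.ne']

theorem exists_contMDiff_turn_eq {c : unitInterval × N → Circle}
    (hc : ContMDiff ((𝓡∂ 1).prod I) (𝓡 1) ∞ c) (hc0 : ∀ x, c (0, x) = 1) :
    ∃ δ : unitInterval × N → ℝ, ContMDiff ((𝓡∂ 1).prod I) 𝓘(ℝ, ℝ) ∞ δ ∧
      (∀ p, turn (δ p) = c p) ∧ ∀ x, δ (0, x) = 0 := by
  have hc0' x : c (0, x) = Circle.exp ((0 : C(N, ℝ)) x) := by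
    rw [hc0, ContinuousMap.zero_apply, Circle.exp_zero]
  let θ : C(unitInterval × N, ℝ) :=
    Circle.isCoveringMap_exp.liftHomotopy ⟨c, hc.continuous⟩ 0 hc0'
  have hθ p : Circle.exp (θ p) = c p :=
    congrFun (Circle.isCoveringMap_exp.liftHomotopy_lifts ⟨c, hc.continuous⟩ 0 hc0') p
  have hθ0 x : θ (0, x) = 0 := Circle.isCoveringMap_exp.liftHomotopy_zero _ 0 hc0' x
  refine ⟨fun p => θ p / (2 * Real.pi),
    (contMDiff_of_circleExp θ.continuous (by simpa only [hθ] using hc)).div_const _,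
    fun p => ?_, fun x => ?_⟩
  · rw [turn, mul_div_cancel₀ _ Real.two_pi_pos.ne', hθ]
  · beta_reduce
    rw [hθ0, zero_div]

theorem exists_continuous_int_of_turn_eq {X Y : Type*} [TopologicalSpace X] [TopologicalSpace Y]
    [PreconnectedSpace Y] [Nonempty Y] {f g : X × Y → ℝ} (hf : Continuous f) (hg : Continuous g)
    (h : ∀ p, turn (f p) = turn (g p)) :
    ∃ k : X → ℤ, Continuous k ∧ ∀ p, f p = g p + k p.1 := by
  choose m hm using fun p => turn_eq_turn_iff.1 (h p)
  have hm_cont : Continuous m := by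
    rw [Int.isClosedEmbedding_coe_real.isInducing.continuous_iff]
    exact (hf.sub hg).congr fun p => sub_eq_iff_eq_add'.2 (hm p)
  obtain ⟨y₀⟩ := ‹Nonempty Y›
  refine ⟨fun x => m (x, y₀), hm_cont.comp (by fun_prop), fun ⟨x, y⟩ => ?_⟩
  rw [hm, PreconnectedSpace.constant inferInstance (f := fun y => m (x, y))
    (hm_cont.comp (by fun_prop)) (x := y) (y := y₀)]

theorem contMDiff_intCast_of_continuous {k : N → ℤ} (hk : Continuous k) :
    ContMDiff I 𝓘(ℝ, ℝ) ∞ fun x => (k x : ℝ) := fun x =>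
  contMDiffAt_const.congr_of_eventuallyEq
    (((IsLocallyConstant.iff_continuous k).2 hk |>.eventually_eq x).mono fun _ hy =>
      congrArg Int.cast hy)

end CircleLift

section Lift

variable {E : Type*} [NormedAddCommGroup E] [NormedSpace ℝ E]
  {H : Type*} [TopologicalSpace H] {I : ModelWithCorners ℝ E H}
  {M : Type*} [TopologicalSpace M] [ChartedSpace H M]

/-- The covering `M × ℝ → M × S¹`. -/
def rollUp {X : Type*} (p : X × ℝ) : X × Circle := (p.1, turn p.2)

theorem contMDiff_rollUp : ContMDiff (I.prod 𝓘(ℝ, ℝ)) (I.prod (𝓡 1)) ∞ (rollUp (X := M)) :=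
  contMDiff_fst.prodMk (contMDiff_turn.comp contMDiff_snd)

theorem rollUp_add_intCast {X : Type*} (x : X) (s : ℝ) (m : ℤ) :
    rollUp (x, s + m) = rollUp (x, s) := by
  simp only [rollUp, turn_add, turn_intCast, mul_one]

theorem exists_isIsotopy_lift {h : unitInterval → Diff (I.prod (𝓡 1)) (M × Circle)}
    (hh : IsIsotopy h) (h0 : h 0 = 1) :
    ∃ k : unitInterval → Diff (I.prod 𝓘(ℝ, ℝ)) (M × ℝ), IsIsotopy k ∧ k 0 = 1 ∧
      (∀ t, k t ∈ periodicDiff I M) ∧ ∀ t p, rollUp (k t p) = h t (rollUp p) := by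
  obtain ⟨δ, hδ, hδ_turn, hδ0⟩ := exists_contMDiff_turn_eq
    (c := fun p : unitInterval × (M × Circle) => (h p.1 p.2).2 / p.2.2)
    ((contMDiff_snd.comp hh.1).div (contMDiff_snd.comp contMDiff_snd))
    fun w => by simp only [h0, one_apply, div_self']
  have hroll : ContMDiff ((𝓡∂ 1).prod (I.prod 𝓘(ℝ, ℝ))) ((𝓡∂ 1).prod (I.prod (𝓡 1))) ∞
      (fun p : unitInterval × (M × ℝ) => (p.1, rollUp p.2)) :=
    contMDiff_fst.prodMk (contMDiff_rollUp.comp contMDiff_snd)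
  have hfwd t (p : M × ℝ) :
      rollUp ((h t (rollUp p)).1, p.2 + δ (t, rollUp p)) = h t (rollUp p) :=
    Prod.ext rfl (by rw [rollUp, turn_add, hδ_turn]; exact mul_div_cancel _ _)
  have hbwd t (p : M × ℝ) : rollUp (((h t)⁻¹ (rollUp p)).1, p.2 - δ (t, (h t)⁻¹ (rollUp p))) =
      (h t)⁻¹ (rollUp p) :=
    Prod.ext rfl (by rw [rollUp, turn_sub, hδ_turn, apply_inv_self]; exact div_div_cancel _ _)
  obtain ⟨k, hk, hk_apply⟩ := exists_isIsotopy_of_inverse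
    (F := fun p : unitInterval × (M × ℝ) =>
      ((h p.1 (rollUp p.2)).1, p.2.2 + δ (p.1, rollUp p.2)))
    (K := fun p => (((h p.1)⁻¹ (rollUp p.2)).1, p.2.2 - δ (p.1, (h p.1)⁻¹ (rollUp p.2))))
    ((contMDiff_fst.comp (hh.1.comp hroll)).prodMk
      ((contMDiff_snd.comp contMDiff_snd).add (hδ.comp hroll)))
    ((contMDiff_fst.comp (hh.2.comp hroll)).prodMk
      ((contMDiff_snd.comp contMDiff_snd).sub
        (hδ.comp (contMDiff_fst.prodMk (hh.2.comp hroll)))))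
    (fun t p => by simp only [hfwd, inv_apply_self, add_sub_cancel_right]; rfl)
    (fun t p => by simp only [hbwd, apply_inv_self, sub_add_cancel]; rfl)
  refine ⟨k, hk, Diffeomorph.ext fun p => ?_, fun t x s m => ?_, fun t p => ?_⟩
  · rw [hk_apply, h0, hδ0, one_apply, one_apply, add_zero]; rfl
  · simp only [hk_apply, rollUp_add_intCast, add_right_comm]
  · rw [hk_apply, hfwd]

theorem exists_isIsotopy_shear {κ : M → ℝ} (hκ : ContMDiff I 𝓘(ℝ, ℝ) ∞ κ) :
    ∃ k : unitInterval → Diff (I.prod 𝓘(ℝ, ℝ)) (M × ℝ), IsIsotopy k ∧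
      ∀ t p, k t p = (p.1, p.2 + t * κ p.1) := by
  have hshift : ContMDiff ((𝓡∂ 1).prod (I.prod 𝓘(ℝ, ℝ))) 𝓘(ℝ, ℝ) ∞
      (fun p : unitInterval × (M × ℝ) => (p.1 : ℝ) * κ p.2.1) :=
    (contMDiff_subtypeVal_Icc.comp contMDiff_fst).mul
      (hκ.comp (contMDiff_fst.comp contMDiff_snd))
  exact exists_isIsotopy_of_inverse
    (F := fun p : unitInterval × (M × ℝ) => (p.2.1, p.2.2 + p.1 * κ p.2.1))
    (K := fun p => (p.2.1, p.2.2 - p.1 * κ p.2.1))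
    ((contMDiff_fst.comp contMDiff_snd).prodMk ((contMDiff_snd.comp contMDiff_snd).add hshift))
    ((contMDiff_fst.comp contMDiff_snd).prodMk ((contMDiff_snd.comp contMDiff_snd).sub hshift))
    (fun _ _ => Prod.ext rfl (add_sub_cancel_right _ _))
    fun _ _ => Prod.ext rfl (sub_add_cancel _ _)

end Lift

section Interval

variable {E : Type*} [NormedAddCommGroup E] [NormedSpace ℝ E]
  {H : Type*} [TopologicalSpace H] {I : ModelWithCorners ℝ E H}
  {M : Type*} [TopologicalSpace M] [ChartedSpace H M]

/-- The inclusion `M × [0,1] → M × ℝ`. -/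
def toLine {X : Type*} (p : X × unitInterval) : X × ℝ := (p.1, p.2)

theorem toLine_injective {X : Type*} : Function.Injective (toLine (X := X)) :=
  Function.injective_id.prodMap Subtype.val_injective

theorem exists_toLine_eq {X : Type*} {p : X × ℝ} (hp : p.2 ∈ Set.Icc 0 1) : ∃ q, toLine q = p :=
  ⟨(p.1, ⟨p.2, hp⟩), rfl⟩

theorem contMDiff_toLine : ContMDiff (I.prod (𝓡∂ 1)) (I.prod 𝓘(ℝ, ℝ)) ∞ (toLine (X := M)) :=
  contMDiff_fst.prodMk (contMDiff_subtypeVal_Icc.comp contMDiff_snd)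

theorem contMDiff_of_toLine_comp {E' : Type*} [NormedAddCommGroup E'] [NormedSpace ℝ E']
    {H' : Type*} [TopologicalSpace H'] {J : ModelWithCorners ℝ E' H'}
    {X : Type*} [TopologicalSpace X] [ChartedSpace H' X] {f : X → M × unitInterval}
    (hf : ContMDiff J (I.prod 𝓘(ℝ, ℝ)) ∞ fun x => toLine (f x)) :
    ContMDiff J (I.prod (𝓡∂ 1)) ∞ f :=
  (contMDiff_fst.comp hf).prodMk (contMDiff_iff_comp_subtypeVal_Icc.2
    ⟨(continuous_snd.comp hf.continuous).subtype_mk _, contMDiff_snd.comp hf⟩)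

theorem boundary_prod_unitInterval [I.Boundaryless] :
    (I.prod (𝓡∂ 1)).boundary (M × unitInterval) = Set.univ ×ˢ ({0, 1} : Set unitInterval) :=
  boundary_product I

theorem eventually_nhdsSet_boundary_notMem_Icc [I.Boundaryless] {ε : ℝ} (hε : 0 < ε) :
    ∀ᶠ p : M × unitInterval in 𝓝ˢ ((I.prod (𝓡∂ 1)).boundary (M × unitInterval)),
      (p.2 : ℝ) ∉ Set.Icc ε (1 - ε) := by
  have hopen : IsOpen {p : M × unitInterval | (p.2 : ℝ) ∉ Set.Icc ε (1 - ε)} :=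
    (isClosed_Icc.preimage (by fun_prop : Continuous fun p : M × unitInterval =>
      (p.2 : ℝ))).isOpen_compl
  rw [boundary_prod_unitInterval]
  refine hopen.mem_nhdsSet.2 fun p ⟨_, hp⟩ hmem => ?_
  rcases hp with h | h
  · exact hε.not_ge (by simpa only [h, Set.Icc.coe_zero] using hmem.1)
  · exact (sub_lt_self 1 hε).not_ge
      (by simpa only [Set.mem_singleton_iff.1 h, Set.Icc.coe_one] using hmem.2)

theorem exists_forall_notMem_Ioo_of_eventually_nhdsSet_boundary [I.Boundaryless] [CompactSpace M]
    {Q : M × unitInterval → Prop}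
    (hQ : ∀ᶠ p in 𝓝ˢ ((I.prod (𝓡∂ 1)).boundary (M × unitInterval)), Q p) :
    ∃ ε : ℝ, 0 < ε ∧ ε ≤ 1 / 2 ∧
      ∀ p : M × unitInterval, (p.2 : ℝ) ∉ Set.Ioo ε (1 - ε) → Q p := by
  have hends : IsCompact ({0, 1} : Set unitInterval) := (Set.toFinite _).isCompact
  rw [boundary_prod_unitInterval, isCompact_univ.nhdsSet_prod_eq hends, nhdsSet_univ,
    Filter.eventually_prod_iff] at hQ
  obtain ⟨_, hx, _, hs, hQ⟩ := hQ
  obtain ⟨δ, hδ, hδQ⟩ := (Metric.hasBasis_nhdsSet_thickening hends).eventually_iff.1 hs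
  refine ⟨min (1 / 2) (δ / 2), by positivity, min_le_left _ _, fun p hp => ?_⟩
  refine hQ (Filter.eventually_top.1 hx p.1) (hδQ (Metric.mem_thickening_iff.2 ?_))
  have hlt : min (1 / 2) (δ / 2) < δ := (min_le_right _ _).trans_lt (half_lt_self hδ)
  rw [Set.mem_Ioo, not_and_or, not_lt, not_lt] at hp
  rcases hp with hp | hp
  · refine ⟨0, Set.mem_insert _ _, ?_⟩
    rw [Subtype.dist_eq, Set.Icc.coe_zero, Real.dist_0_eq_abs, abs_of_nonneg p.2.2.1]
    exact hp.trans_lt hlt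
  · refine ⟨1, Set.mem_insert_of_mem _ rfl, ?_⟩
    rw [dist_comm, Subtype.dist_eq, Set.Icc.coe_one, Real.dist_eq,
      abs_of_nonneg (sub_nonneg.2 p.2.2.2)]
    exact (sub_le_comm.1 hp).trans_lt hlt

theorem exists_isIsotopyRel_of_eq_self_of_notMem_Icc [I.Boundaryless]
    {R : unitInterval → Diff (I.prod 𝓘(ℝ, ℝ)) (M × ℝ)} (hR : IsIsotopy R) {ε : ℝ} (hε : 0 < ε)
    (hfix : ∀ t p, p.2 ∉ Set.Icc ε (1 - ε) → R t p = p) :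
    ∃ k : unitInterval → diffRel (I.prod (𝓡∂ 1)) (M × unitInterval), IsIsotopyRel k ∧
      ∀ t p, toLine ((k t).1 p) = R t (toLine p) := by
  have hmaps {φ : Diff (I.prod 𝓘(ℝ, ℝ)) (M × ℝ)} (hφ : ∀ p, p.2 ∉ Set.Icc ε (1 - ε) → φ p = p)
      (p : M × unitInterval) : ∃ q, toLine q = φ (toLine p) := by
    refine exists_toLine_eq (by_contra fun hout => hout ?_)
    have hfixed : φ (φ (toLine p)) = φ (toLine p) :=
      hφ _ fun hmem => hout ⟨hε.le.trans hmem.1, hmem.2.trans (sub_le_self 1 hε.le)⟩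
    rw [φ.injective hfixed]
    exact p.2.2
  have hfix_inv t (p : M × ℝ) (hp : p.2 ∉ Set.Icc ε (1 - ε)) : (R t)⁻¹ p = p := by
    conv_lhs => rw [← hfix t p hp, inv_apply_self]
  choose F hF using fun t => hmaps (hfix t)
  choose K hK using fun t => hmaps (hfix_inv t)
  have hsmooth {R : unitInterval × (M × ℝ) → M × ℝ}
      (hR : ContMDiff ((𝓡∂ 1).prod (I.prod 𝓘(ℝ, ℝ))) (I.prod 𝓘(ℝ, ℝ)) ∞ R) :
      ContMDiff ((𝓡∂ 1).prod (I.prod (𝓡∂ 1))) (I.prod 𝓘(ℝ, ℝ)) ∞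
        (fun p : unitInterval × (M × unitInterval) => R (p.1, toLine p.2)) :=
    hR.comp (contMDiff_fst.prodMk (contMDiff_toLine.comp contMDiff_snd))
  obtain ⟨k, hk, hk_apply⟩ := exists_isIsotopy_of_inverse
    (F := fun p : unitInterval × (M × unitInterval) => F p.1 p.2) (K := fun p => K p.1 p.2)
    (contMDiff_of_toLine_comp (by simpa only [hF] using hsmooth hR.1))
    (contMDiff_of_toLine_comp (by simpa only [hK] using hsmooth hR.2))
    (fun t p => toLine_injective (by simp only [hK, hF, inv_apply_self]))
    fun t p => toLine_injective (by simp only [hK, hF, apply_inv_self])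
  have hk_fix : ∀ᶠ p in 𝓝ˢ ((I.prod (𝓡∂ 1)).boundary (M × unitInterval)), ∀ t, k t p = p := by
    filter_upwards [eventually_nhdsSet_boundary_notMem_Icc hε] with p hp t
    exact toLine_injective (by rw [hk_apply, hF, hfix t (toLine p) hp])
  exact ⟨fun t => ⟨k t, hk_fix.mono fun p hp => hp t⟩, ⟨hk, hk_fix⟩,
    fun t p => by rw [← hF, hk_apply]⟩

end Interval

section Closing

variable {n : ℕ} {M : Type*} [TopologicalSpace M] [ChartedSpace (EuclideanSpace ℝ (Fin n)) M]

theorem exists_isIsotopy_extending_of_isotopic_closeUp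
    {g : diffRel ((𝓡 n).prod (𝓡∂ 1)) (M × unitInterval)} (hg : Isotopic 1 (closeUp g)) :
    ∃ h : unitInterval → Diff ((𝓡 n).prod 𝓘(ℝ, ℝ)) (M × ℝ), IsIsotopy h ∧ h 0 = 1 ∧
      (∀ t, h t ∈ periodicDiff (𝓡 n) M) ∧ ∀ p, h 1 (toLine p) = toLine (g.1 p) := by
  obtain ⟨f, hf, hf0, hf1⟩ := hg
  obtain ⟨k, hk, hk0, hk_per, hk_roll⟩ := exists_isIsotopy_lift hf hf0
  have hroll (p : M × unitInterval) : rollUp (k 1 (toLine p)) = rollUp (toLine (g.1 p)) := by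
    rw [hk_roll, hf1]
    exact closeUp_glueEnds g p
  obtain ⟨m, hm, hkm⟩ := exists_continuous_int_of_turn_eq
    (f := fun p : M × unitInterval => (k 1 (toLine p)).2) (g := fun p => (toLine (g.1 p)).2)
    (continuous_snd.comp ((k 1).continuous.comp (contMDiff_toLine (I := 𝓡 n)).continuous))
    (continuous_snd.comp ((contMDiff_toLine (I := 𝓡 n)).continuous.comp g.1.continuous))
    fun p => congrArg Prod.snd (hroll p)
  obtain ⟨v, hv, hv_apply⟩ := exists_isIsotopy_shear
    (contMDiff_intCast_of_continuous (I := 𝓡 n) hm).neg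
  refine ⟨fun t => k t * v t, hk.mul hv, Diffeomorph.ext fun p => ?_,
    fun t => mul_mem (hk_per t) fun x s j => ?_, fun p => ?_⟩
  · simp only [mul_apply, hk0, hv_apply, Set.Icc.coe_zero, zero_mul, add_zero]
  · simp only [hv_apply, add_right_comm]
  · have hshift := mem_periodicDiff.1 (hk_per 1) p.1 p.2 (-m p.1)
    simp only [mul_apply, hv_apply, Set.Icc.coe_one, one_mul, Int.cast_neg] at hshift ⊢
    have hfst : (k 1 (toLine p)).1 = (g.1 p).1 := congrArg (fun w => w.1) (hroll p)
    exact hshift.trans (Prod.ext hfst (add_neg_eq_iff_eq_add.2 (hkm p)))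

theorem isotopicRel_one_of_isotopic_closeUp [CompactSpace M] [IsManifold (𝓡 n) ∞ M]
    {g : diffRel ((𝓡 n).prod (𝓡∂ 1)) (M × unitInterval)} (hg : Isotopic (closeUp g) 1) :
    IsotopicRel g 1 := by
  rw [← mk_eq_mk_iff, eq_comm, mk_eq_mk_iff] at hg
  rw [← mk_eq_mk_rel_iff, eq_comm, mk_eq_mk_rel_iff]
  obtain ⟨ε, hε, hε_le, hgε⟩ := exists_forall_notMem_Ioo_of_eventually_nhdsSet_boundary g.2
  obtain ⟨h, hh, h0, hper, h1⟩ := exists_isIsotopy_extending_of_isotopic_closeUp hg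
  have h1_inv p : (h 1)⁻¹ (toLine p) = toLine ((g.1)⁻¹ p) :=
    by rw [← apply_inv_self g.1 p, ← h1, inv_apply_self, apply_inv_self]
  obtain ⟨R, hR, hR0, hR_fix, hR1⟩ := exists_isIsotopy_eq_self_of_notMem_Icc hh h0 hper hε hε_le
    (fun p hp hpε => by
      obtain ⟨q, rfl⟩ := exists_toLine_eq hp
      rw [h1, hgε q hpε])
    (height_nonneg_iff (hper 1)
      (fun p hp => by
        obtain ⟨q, rfl⟩ := exists_toLine_eq hp
        rw [h1]
        exact (g.1 q).2.2.1)
      fun p hp => by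
        obtain ⟨q, rfl⟩ := exists_toLine_eq hp
        rw [h1_inv]
        exact ((g.1)⁻¹ q).2.2.1)
  obtain ⟨k, hk, hkR⟩ := exists_isIsotopyRel_of_eq_self_of_notMem_Icc hR (half_pos hε) hR_fix
  refine ⟨k, hk, Subtype.ext (Diffeomorph.ext fun p => toLine_injective ?_),
    Subtype.ext (Diffeomorph.ext fun p => toLine_injective ?_)⟩
  · rw [hkR, hR0]
    rfl
  · rw [hkR, hR1 _ p.2.2, h1]

theorem piZeroCloseUp_injective [CompactSpace M] [IsManifold (𝓡 n) ∞ M] :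
    Function.Injective (piZeroCloseUp n M) := by
  rw [injective_iff_map_eq_one]
  intro a ha
  obtain ⟨g, rfl⟩ := QuotientGroup.mk_surjective a
  exact (mk_eq_mk_rel_iff g 1).2
    (isotopicRel_one_of_isotopic_closeUp ((mk_eq_mk_iff (closeUp g) 1).1 ha))

end Closing

end ClosingClam

end

theorem mainTheorem5_general (n : ℕ) (M : Type*) [TopologicalSpace M] [CompactSpace M]
    [ChartedSpace (EuclideanSpace ℝ (Fin n)) M] [IsManifold (𝓡 n) ∞ M] :
    Function.Injective (ClosingClam.piZeroCloseUp n M) ∧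
      ∀ g : ClosingClam.diffRel ((𝓡 n).prod (𝓡∂ 1)) (M × unitInterval),
        ClosingClam.Isotopic (ClosingClam.closeUp g) 1 → ClosingClam.IsotopicRel g 1 :=
  ⟨ClosingClam.piZeroCloseUp_injective, fun _ => ClosingClam.isotopicRel_one_of_isotopic_closeUp⟩

theorem mainTheorem5 (n : ℕ) (M : Type*) [TopologicalSpace M] [T2Space M] [CompactSpace M]
    [ChartedSpace (EuclideanSpace ℝ (Fin n)) M] [IsManifold (𝓡 n) ∞ M] :
    Function.Injective (ClosingClam.piZeroCloseUp n M) ∧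
      ∀ g : ClosingClam.diffRel ((𝓡 n).prod (𝓡∂ 1)) (M × unitInterval),
        ClosingClam.Isotopic (ClosingClam.closeUp g) 1 → ClosingClam.IsotopicRel g 1 :=
  mainTheorem5_general n M
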